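/- Let $G$ be a finite group with $c$ conjugacy classes and let $z(G)$ be the number of elements of its center. A union $S\subseteq G$ of conjugacy classes is a rack under $a\triangleright b=aba^{-1}$. A subset $Q\subseteq S$ is a subrack of $S$ if it is a rack under the same operation, i.e. if $a\triangleright b\in Q$ for all $a,b\in Q$ and for all $a,b\in Q$ there is a unique $x\in Q$ with $a\triangleright x=b$. Let $\mathcal R(S)$ be the set of all subracks of $S$ (including $\emptyset$ and $S$), ordered by inclusion, and let $\Delta(\mathcal R(S))$ be its order complex, the simplicial complex of all chains in $\mathcal R(S)\setminus\{\emptyset,S\}$. For an integer $d$, the $d$-sphere is the unit sphere of $\mathbb R^{d+1}$ if $d\ge 0$, and the empty space if $d<0$. Let $R$ be the union of all non-central conjugacy classes of $G$ (those with more than one element), and let $Z$ be any set of central elements of $G$. Then 1. $\mathcal R(R\cup Z)\cong\mathcal R(R)\times 2^Z$ as partially ordered sets, where $2^Z$ is the set of all subsets of $Z$ ordered by inclusion and the product is ordered componentwise; 2. the geometric realization of $\Delta(\mathcal R(R\cup Z))$ is homotopy equivalent to a $(c-z(G)+|Z|-2)$-sphere. In particular, the geometric realization of $\Delta(\mathcal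 R(G))$ is homotopy equivalent to a $(c-2)$-sphere. -/

import Mathlib

open scoped Quandles ContinuousMap

/-- A subset `Q` of a rack `X` is a subrack if it is a rack under the operation of `X`: it is
closed under the operation, and for all `a, b ∈ Q` there is a unique `c ∈ Q` with `a ◃ c = b`.
(Self-distributivity on `Q` is inherited from `X`.) -/
structure IsSubrack {X : Type*} [Rack X] (Q : Set X) : Prop where
  act_mem : ∀ a ∈ Q, ∀ b ∈ Q, a ◃ b ∈ Q
  existsUnique_act : ∀ a ∈ Q, ∀ b ∈ Q, ∃! c, c ∈ Q ∧ a ◃ c = b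

/-- For a set `S` that is a rack under the operation of the rack `X`, the poset of all subracks
of `S`. As a subtype of `Set X`, it is ordered by inclusion. -/
abbrev SubrackPoset {X : Type*} [Rack X] (S : Set X) : Type _ :=
  {Q : Set X // Q ⊆ S ∧ IsSubrack Q}

/-- For a set `S` of elements of a group `G` (in practice a union of conjugacy classes), the poset
of all subracks of `S` for the operation `a ◃ b = a * b * a⁻¹`. -/
abbrev ConjSubracks {G : Type*} [Group G] (S : Set G) : Type _ :=
  SubrackPoset (X := Quandle.Conj G) S

/-- The poset of subracks of `S` with its least element `∅` and its greatest element `S` removed. -/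
abbrev ProperConjSubracks {G : Type*} [Group G] (S : Set G) : Type _ :=
  {Q : ConjSubracks S // Q.1 ≠ (∅ : Set G) ∧ Q.1 ≠ S}

/-- The simplicial complex of all (finite, nonempty) chains in a partially ordered set. -/
def chainComplexOf (P : Type*) [PartialOrder P] : AbstractSimplicialComplex P where
  faces := {s : Finset P | s.Nonempty ∧ IsChain (· ≤ ·) (s : Set P)}
  isRelLowerSet_faces := by
    intro s hs
    exact ⟨hs.1, fun t hts ht => ⟨ht, hs.2.mono (Finset.coe_subset.mpr hts)⟩⟩
  singleton_mem v := ⟨Finset.singleton_nonempty v, by simp⟩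

/-- The order complex of the poset of subracks of `S`: its faces are the chains of subracks
different from `∅` and `S`. -/
def subrackOrderComplex {G : Type*} [Group G] (S : Set G) :
    AbstractSimplicialComplex (ProperConjSubracks S) :=
  chainComplexOf (ProperConjSubracks S)

/-- The geometric realization of a simplicial complex on a finite vertex set `V`: all convex
combinations, inside `ℝ ^ V`, of the vertices of a face, with the subspace topology. -/
def geomRealization {V : Type*} [Finite V] (K : AbstractSimplicialComplex V) : Set (V → ℝ) :=
  {x | ∃ s ∈ K.faces, (∀ v, 0 ≤ x v) ∧ (∀ v ∉ s, x v = 0) ∧ ∑ v ∈ s, x v = 1}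

/-- The `d`-dimensional sphere: the unit sphere of Euclidean `(d + 1)`-space. It is empty if
`d < 0`; in particular the `(-1)`-sphere is the empty space. -/
abbrev SphereOfDim (d : ℤ) : Set (EuclideanSpace ℝ (Fin (d + 1).toNat)) :=
  Metric.sphere 0 1

/-- The union of all non-central conjugacy classes of `G`, that is, of those conjugacy classes
that have more than one element. -/
def noncentralRack (G : Type*) [Group G] : Set G :=
  ⋃ C ∈ ConjClasses.noncenter G, C.carrier

/-! For a set `I` of conjugacy classes containing all non-central ones, send a subrack of their
union to the set of classes it meets. The key point is that a proper subrack `Q` never meets all of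
`I`. If it did, the normalizer of `Q`, which contains both `Q` and the center, would meet every
conjugacy class of `G`. By Jordan's theorem it would be `G`, so `Q` would be a union of classes and
hence everything (`eq_preimage_of_image_eq`).

Thus the proper part of the subrack poset maps to the proper part of the Boolean lattice on `I`.
Taking unions of classes is a section of this map, and the composite on subracks only enlarges them,
so the realizations are homotopy equivalent (`nonempty_realization_homotopyEquiv`). The Boolean side
is the barycentric subdivision of the boundary of a simplex with `|I|` vertices, a sphere of
dimension `|I| - 2`; here `|I| = c - z(G) + |Z|`.

The product decomposition holds because central elements act trivially and are fixed by conjugation.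
-/

/-! ### Monotone maps and homotopies of order complexes -/

section OrderComplexRealization

variable {P Q T : Type*} [PartialOrder P] [PartialOrder Q] [PartialOrder T]

/-- A point of the realization of an order complex is a probability vector whose support is a
chain. -/
theorem mem_geomRealization_chainComplexOf [Fintype P] {x : P → ℝ} :
    x ∈ geomRealization (chainComplexOf P) ↔
      (∀ v, 0 ≤ x v) ∧ ∑ v, x v = 1 ∧ IsChain (· ≤ ·) {v | 0 < x v} := by
  classical
  constructor
  · rintro ⟨s, hs, h0, hsupp, hsum⟩
    refine ⟨h0, ?_, hs.2.mono fun v hv => ?_⟩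
    · rw [← hsum]
      exact (Finset.sum_subset (Finset.subset_univ s) fun v _ hv => hsupp v hv).symm
    · by_contra h
      exact (ne_of_gt hv) (hsupp v h)
  · rintro ⟨h0, hsum, hchain⟩
    have hsupp : ∀ v ∉ Finset.univ.filter (fun v => 0 < x v), x v = 0 := fun v hv =>
      le_antisymm (not_lt.1 fun h => hv (by simpa using h)) (h0 v)
    have hsum' : ∑ v ∈ Finset.univ.filter (fun v => 0 < x v), x v = 1 := by
      rw [← hsum]
      exact Finset.sum_subset (Finset.subset_univ _) fun v _ hv => hsupp v hv
    refine ⟨Finset.univ.filter (fun v => 0 < x v), ⟨?_, by simpa using hchain⟩, h0, hsupp, hsum'⟩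
    rw [Finset.nonempty_iff_ne_empty]
    intro h
    rw [h] at hsum'
    simp at hsum'

open Classical in
/-- The image of a finitely supported mass distribution under a map of index sets. -/
noncomputable def massPush {V W : Type*} [Fintype V] (f : V → W) (x : V → ℝ) (w : W) : ℝ :=
  ∑ v with f v = w, x v

section massPush

variable {V W U : Type*} [Fintype V]

theorem massPush_id (x : V → ℝ) : massPush id x = x := by
  classical
  ext w
  simp [massPush, Finset.sum_filter]

theorem massPush_comp [Fintype W] (g : W → U) (f : V → W) (x : V → ℝ) :
    massPush g (massPush f x) = massPush (g ∘ f) x := by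
  classical
  ext u
  simp only [massPush, Finset.sum_filter, Function.comp]
  simp_rw [← Finset.sum_filter (p := fun w => g w = u)]
  rw [Finset.sum_comm]
  refine Finset.sum_congr rfl fun v _ => ?_
  simp

theorem sum_massPush [Fintype W] (f : V → W) (x : V → ℝ) : ∑ w, massPush f x w = ∑ v, x v := by
  classical
  exact Finset.sum_fiberwise _ _ _

theorem massPush_nonneg (f : V → W) {x : V → ℝ} (hx : ∀ v, 0 ≤ x v) (w : W) :
    0 ≤ massPush f x w :=
  Finset.sum_nonneg fun v _ => hx v

theorem exists_of_massPush_pos {f : V → W} {x : V → ℝ} {w : W} (h : 0 < massPush f x w) :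
    ∃ v, f v = w ∧ 0 < x v := by
  classical
  obtain ⟨v, hv, hpos⟩ := Finset.exists_lt_of_sum_lt
    (s := Finset.univ.filter (fun v => f v = w)) (f := fun _ => (0 : ℝ)) (g := x)
    (by simpa [massPush] using h)
  exact ⟨v, by simpa using hv, hpos⟩

theorem continuous_massPush (f : V → W) : Continuous (massPush f) := by
  unfold massPush
  fun_prop

end massPush

/-- The map of realizations induced by a monotone map. -/
noncomputable def realizationMap [Fintype P] [Fintype Q] (f : P →o Q) :
    C(geomRealization (chainComplexOf P), geomRealization (chainComplexOf Q)) where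
  toFun x := ⟨massPush f x.1, by
    obtain ⟨h0, hsum, hchain⟩ := mem_geomRealization_chainComplexOf.1 x.2
    refine mem_geomRealization_chainComplexOf.2
      ⟨massPush_nonneg f h0, by rw [sum_massPush, hsum], ?_⟩
    intro a ha b hb _
    obtain ⟨u, rfl, hu⟩ := exists_of_massPush_pos ha
    obtain ⟨v, rfl, hv⟩ := exists_of_massPush_pos hb
    exact (hchain.total hu hv).imp (fun h => f.monotone h) (fun h => f.monotone h)⟩
  continuous_toFun := by
    exact ((continuous_massPush f).comp continuous_subtype_val).subtype_mk _

theorem realizationMap_comp [Fintype P] [Fintype Q] [Fintype T] (g : Q →o T) (f : P →o Q) :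
    (realizationMap g).comp (realizationMap f) = realizationMap (g.comp f) := by
  ext x : 2
  exact massPush_comp g f x.1

theorem realizationMap_id [Fintype P] :
    realizationMap (OrderHom.id : P →o P) = ContinuousMap.id _ := by
  ext x : 2
  exact massPush_id x.1

open Classical in
/-- The part of the mass at `v` that has been released at time `t`, when the mass of `x` is
released at unit speed from the top of the chain downwards. -/
noncomputable def releasedMass [Fintype P] (t : ℝ) (x : P → ℝ) (v : P) : ℝ :=
  min (x v) (max 0 (t - ∑ u with v < u, x u))

section releasedMass

variable [Fintype P]

theorem releasedMass_nonneg {x : P → ℝ} (hx : ∀ v, 0 ≤ x v) (t : ℝ) (v : P) :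
    0 ≤ releasedMass t x v :=
  le_min (hx v) (le_max_left _ _)

theorem releasedMass_le (x : P → ℝ) (t : ℝ) (v : P) : releasedMass t x v ≤ x v :=
  min_le_left _ _

theorem releasedMass_zero {x : P → ℝ} (hx : ∀ v, 0 ≤ x v) : releasedMass 0 x = 0 := by
  classical
  ext v
  have h : 0 ≤ ∑ u with v < u, x u := Finset.sum_nonneg fun u _ => hx u
  have : max 0 (0 - ∑ u with v < u, x u) = 0 := max_eq_left (by linarith)
  rw [releasedMass, this]
  exact min_eq_right (hx v)

theorem add_sum_gt_le_sum_gt {x : P → ℝ} (hx : ∀ v, 0 ≤ x v) {v : P} {s : Finset P}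
    (hv : v ∈ s) (hs : ∀ u, v < u → u ∈ s) [DecidablePred (v < ·)] :
    x v + ∑ u with v < u, x u ≤ ∑ u ∈ s, x u := by
  classical
  rw [← Finset.sum_insert (by simp)]
  refine Finset.sum_le_sum_of_subset_of_nonneg ?_ fun u _ _ => hx u
  intro u hu
  rcases Finset.mem_insert.1 hu with rfl | hu
  · exact hv
  · exact hs u (by simpa using hu)

theorem releasedMass_one {x : P → ℝ} (hx : ∀ v, 0 ≤ x v) (hsum : ∑ v, x v = 1) :
    releasedMass 1 x = x := by
  classical
  ext v
  have h := add_sum_gt_le_sum_gt hx (Finset.mem_univ v) fun u _ => Finset.mem_univ u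
  exact min_eq_left ((by linarith : x v ≤ 1 - ∑ u with v < u, x u).trans (le_max_right _ _))

/-- Mass is released from the top: below a vertex that is not yet fully released, nothing has been
released. -/
theorem le_of_released_of_unreleased {x : P → ℝ} (hx : ∀ v, 0 ≤ x v)
    (hchain : IsChain (· ≤ ·) {v | 0 < x v}) {t : ℝ} {u v : P}
    (hu : releasedMass t x u < x u) (hv : 0 < releasedMass t x v) : u ≤ v := by
  classical
  have hxv : 0 < x v := hv.trans_le (releasedMass_le x t v)
  have hxu : 0 < x u := (releasedMass_nonneg hx t u).trans_lt hu
  have h1 : t - ∑ w with u < w, x w < x u := by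
    rw [releasedMass, min_lt_iff] at hu
    exact (max_lt_iff.1 (hu.resolve_left (lt_irrefl _))).2
  have h2 : 0 < t - ∑ w with v < w, x w := by
    rw [releasedMass, lt_min_iff] at hv
    exact (lt_max_iff.1 hv.2).resolve_left (lt_irrefl _)
  -- If `v < u`, the mass strictly above `v` is at least `x u` plus the mass above `u`, hence
  -- exceeds `t`, so `v` could not have begun to be released.
  by_contra hle
  have hlt : v < u := lt_of_le_not_ge ((hchain.total hxu hxv).resolve_left hle) hle
  have := add_sum_gt_le_sum_gt hx (v := u) (s := Finset.univ.filter (v < ·)) (by simpa using hlt)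
    fun w hw => by simpa using hlt.trans hw
  linarith

theorem continuous_releasedMass :
    Continuous fun p : ℝ × (P → ℝ) => releasedMass p.1 p.2 := by
  unfold releasedMass
  fun_prop

end releasedMass

/-- The homotopy that pushes mass upwards along `f`, starting at the top. -/
noncomputable def slide [Fintype P] (f : P → P) (t : ℝ) (x : P → ℝ) : P → ℝ :=
  x - releasedMass t x + massPush f (releasedMass t x)

/-- A straight-line homotopy could leave the complex: for `v < u` in the chain, `f v` and `u` may be
incomparable. Releasing from the top keeps every unreleased vertex below every released `v`, hence
below `f v`. -/
theorem slide_mem [Fintype P] (f : P →o P) (hf : ∀ v, v ≤ f v) (t : ℝ) {x : P → ℝ}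
    (hx : x ∈ geomRealization (chainComplexOf P)) :
    slide f t x ∈ geomRealization (chainComplexOf P) := by
  obtain ⟨h0, hsum, hchain⟩ := mem_geomRealization_chainComplexOf.1 hx
  have hr := releasedMass_nonneg h0 t
  have hpush := massPush_nonneg f hr
  refine mem_geomRealization_chainComplexOf.2 ⟨fun v => ?_, ?_, ?_⟩
  · simp only [slide, Pi.add_apply, Pi.sub_apply]
    linarith [hpush v, releasedMass_le x t v]
  · simp only [slide, Pi.add_apply, Pi.sub_apply, Finset.sum_add_distrib,
      Finset.sum_sub_distrib, sum_massPush, hsum]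
    ring
  · have key : ∀ v, 0 < slide f t x v →
        releasedMass t x v < x v ∨ ∃ u, f u = v ∧ 0 < releasedMass t x u := by
      intro v hv
      by_cases h : 0 < massPush f (releasedMass t x) v
      · exact Or.inr (exists_of_massPush_pos h)
      · simp only [slide, Pi.add_apply, Pi.sub_apply] at hv
        left
        linarith
    intro a ha b hb _
    rcases key a ha with hra | ⟨a, rfl, hra⟩ <;> rcases key b hb with hrb | ⟨b, rfl, hrb⟩
    · exact hchain.total ((hr a).trans_lt hra) ((hr b).trans_lt hrb)
    · exact Or.inl ((le_of_released_of_unreleased h0 hchain hra hrb).trans (hf b))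
    · exact Or.inr ((le_of_released_of_unreleased h0 hchain hrb hra).trans (hf a))
    · exact (hchain.total (hra.trans_le (releasedMass_le x t a))
        (hrb.trans_le (releasedMass_le x t b))).imp (fun h => f.monotone h) (fun h => f.monotone h)

theorem continuous_slide [Fintype P] (f : P → P) :
    Continuous fun p : ℝ × (P → ℝ) => slide f p.1 p.2 := by
  unfold slide
  exact (continuous_snd.sub continuous_releasedMass).add
    ((continuous_massPush f).comp continuous_releasedMass)

/-- An increasing monotone self-map of a finite poset induces a map homotopic to the identity. -/
theorem realizationMap_homotopic_id [Fintype P] (f : P →o P) (hf : ∀ v, v ≤ f v) :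
    (realizationMap f).Homotopic (ContinuousMap.id _) := by
  refine ContinuousMap.Homotopic.symm ⟨⟨⟨fun p => ⟨slide f p.1 p.2.1, slide_mem f hf p.1 p.2.2⟩,
    ?_⟩, fun x => Subtype.ext ?_, fun x => Subtype.ext ?_⟩⟩
  · exact ((continuous_slide f).comp (f := fun p : unitInterval × geomRealization (chainComplexOf P)
      => ((p.1 : ℝ), p.2.1)) (by fun_prop)).subtype_mk _
  · have h0 := (mem_geomRealization_chainComplexOf.1 x.2).1
    ext v
    simp [slide, releasedMass_zero h0, massPush]
  · obtain ⟨h0, hsum, -⟩ := mem_geomRealization_chainComplexOf.1 x.2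
    simp [slide, releasedMass_one h0 hsum, realizationMap]

/-- A monotone map with a monotone section that is increasing on the source induces a homotopy
equivalence of realizations. -/
theorem nonempty_realization_homotopyEquiv [Finite P] [Finite Q] (f : P →o Q) (g : Q →o P)
    (hfg : ∀ q, f (g q) = q) (hgf : ∀ p, p ≤ g (f p)) :
    Nonempty (geomRealization (chainComplexOf P) ≃ₕ geomRealization (chainComplexOf Q)) := by
  have := Fintype.ofFinite P
  have := Fintype.ofFinite Q
  refine ⟨⟨realizationMap f, realizationMap g, ?_, ?_⟩⟩
  · rw [realizationMap_comp]
    exact realizationMap_homotopic_id _ hgf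
  · rw [realizationMap_comp, show f.comp g = OrderHom.id from OrderHom.ext _ _ (funext hfg),
      realizationMap_id]

end OrderComplexRealization

/-! ### Jordan's theorem via Burnside's lemma -/

section JordanCover

/-- **Jordan's theorem**: a finite group is not the union of the conjugates of a proper
subgroup. -/
theorem Subgroup.eq_top_of_forall_exists_isConj {G : Type*} [Group G] [Finite G] (H : Subgroup G)
    (h : ∀ g : G, ∃ k ∈ H, IsConj k g) : H = ⊤ := by
  classical
  have := Fintype.ofFinite G
  have := Fintype.ofFinite (G ⧸ H)
  have := fun g : G => Fintype.ofFinite (MulAction.fixedBy (G ⧸ H) g)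
  have := Fintype.ofFinite (Quotient (MulAction.orbitRel G (G ⧸ H)))
  have hburn := MulAction.sum_card_fixedBy_eq_card_orbits_mul_card_group G (G ⧸ H)
  have horb : Fintype.card (Quotient (MulAction.orbitRel G (G ⧸ H))) = 1 :=
    Fintype.card_eq_one_iff_nonempty_unique.2
      ((MulAction.pretransitive_iff_unique_quotient_of_nonempty G (G ⧸ H)).1 inferInstance)
  have hpos : ∀ g : G, 1 ≤ Fintype.card (MulAction.fixedBy (G ⧸ H) g) := fun g => by
    obtain ⟨k, hk, hkg⟩ := h g
    obtain ⟨c, rfl⟩ := isConj_iff.1 hkg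
    -- An element `c * k * c⁻¹` with `k ∈ H` fixes the coset `cH`.
    refine Fintype.card_pos_iff.2 ⟨⟨(c : G ⧸ H), ?_⟩⟩
    rw [MulAction.mem_fixedBy, MulAction.Quotient.smul_coe, smul_eq_mul, inv_mul_cancel_right]
    exact (QuotientGroup.eq.2 (by simpa using hk)).symm
  rw [horb, one_mul, ← Finset.card_univ, Finset.card_eq_sum_ones] at hburn
  -- By transitivity the fixed-point counts sum to `|G|`; each is at least 1, so each is exactly 1.
  -- At the identity the count is the index of `H`.
  have hone := (Finset.sum_eq_sum_iff_of_le fun g _ => hpos g).1 hburn.symm 1 (Finset.mem_univ 1)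
  rw [← Subgroup.index_eq_one, Subgroup.index_eq_card, Nat.card_eq_fintype_card, hone,
    Fintype.card_eq]
  exact ⟨(Equiv.subtypeUnivEquiv fun q => by simp).symm⟩

end JordanCover

/-! ### Subracks and conjugacy classes -/

section ConjSubracks

variable {G : Type*} [Group G]

/-- In a finite group, a subrack for conjugation is the same as a subset closed under
conjugation by its own elements. -/
theorem isSubrack_conj_iff [Finite G] {Q : Set G} :
    IsSubrack (X := Quandle.Conj G) Q ↔ ∀ a ∈ Q, ∀ b ∈ Q, a * b * a⁻¹ ∈ Q := by
  refine ⟨fun h a ha b hb => h.act_mem a ha b hb, fun h => ⟨fun a ha b hb => h a ha b hb, ?_⟩⟩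
  intro a ha b hb
  have hsurj : Function.Surjective fun c : Q => (⟨a * c * a⁻¹, h a ha c c.2⟩ : Q) :=
    Finite.surjective_of_injective fun c d hcd => by
      have : a * (c : G) * a⁻¹ = a * d * a⁻¹ := congrArg Subtype.val hcd
      exact Subtype.ext (by simpa using this)
  obtain ⟨c, hc⟩ := hsurj ⟨b, hb⟩
  have hcb : a * (c : G) * a⁻¹ = b := congrArg Subtype.val hc
  refine ⟨c, ⟨c.2, hcb⟩, fun d hd => ?_⟩
  have hdb : a * d * a⁻¹ = b := hd.2
  simpa using hdb.trans hcb.symm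

theorem isSubrack_preimage_mk [Finite G] (J : Set (ConjClasses G)) :
    IsSubrack (X := Quandle.Conj G) (ConjClasses.mk ⁻¹' J) := by
  refine isSubrack_conj_iff.2 fun a _ b hb => ?_
  have : ConjClasses.mk (a * b * a⁻¹) = ConjClasses.mk b :=
    ConjClasses.mk_eq_mk_iff_isConj.2 (isConj_iff.2 ⟨a, rfl⟩).symm
  simpa [this] using hb

theorem mk_mem_noncenter_iff {g : G} :
    ConjClasses.mk g ∈ ConjClasses.noncenter G ↔ g ∉ Subgroup.center G := by
  constructor
  · intro h hg
    exact (ConjClasses.mk_bijOn G).mapsTo hg h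
  · intro h
    by_contra hn
    obtain ⟨k, hk, hkg⟩ := (ConjClasses.mk_bijOn G).surjOn hn
    obtain ⟨c, rfl⟩ := isConj_iff.1 (ConjClasses.mk_eq_mk_iff_isConj.1 hkg)
    refine h ?_
    rw [Subgroup.mem_center_iff.1 hk c]
    simpa using hk

theorem noncentralRack_eq_preimage :
    noncentralRack G = ConjClasses.mk ⁻¹' ConjClasses.noncenter G := by
  ext g
  simp [noncentralRack, ConjClasses.mem_carrier_iff_mk_eq]

theorem noncentralRack_eq_compl_center :
    noncentralRack G = (Subgroup.center G : Set G)ᶜ := by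
  ext g
  rw [noncentralRack_eq_preimage]
  exact mk_mem_noncenter_iff

/-- A subrack that meets all non-central conjugacy classes is closed under conjugation by the whole
group. -/
theorem conj_mem_of_noncenter_subset_image [Finite G] {Q : Set G}
    (hQ : IsSubrack (X := Quandle.Conj G) Q) (hmeet : ConjClasses.noncenter G ⊆ ConjClasses.mk '' Q)
    (g : G) {q : G} (hq : q ∈ Q) : g * q * g⁻¹ ∈ Q := by
  have htop : Subgroup.normalizer Q = ⊤ := by
    refine Subgroup.eq_top_of_forall_exists_isConj _ fun g => ?_
    by_cases hg : g ∈ Subgroup.center G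
    · refine ⟨g, ?_, IsConj.refl g⟩
      change ∀ n, n ∈ Q ↔ g * n * g⁻¹ ∈ Q
      intro n
      rw [← Subgroup.mem_center_iff.1 hg n, mul_inv_cancel_right]
    · obtain ⟨a, ha, hag⟩ := hmeet (mk_mem_noncenter_iff.2 hg)
      refine ⟨a, ?_, ConjClasses.mk_eq_mk_iff_isConj.1 hag⟩
      change ∀ n, n ∈ Q ↔ a * n * a⁻¹ ∈ Q
      refine fun n => ⟨hQ.act_mem a ha n, fun hn => ?_⟩
      -- Solvability of `a ◃ c = b` inside `Q` gives the converse inclusion needed for `a` to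
      -- normalize `Q`.
      obtain ⟨c, ⟨hc, hcn⟩, -⟩ := hQ.existsUnique_act a ha _ hn
      have hcn : a * c * a⁻¹ = a * n * a⁻¹ := hcn
      rwa [← mul_left_cancel (mul_right_cancel hcn)]
  have hg : ∀ n, n ∈ Q ↔ g * n * g⁻¹ ∈ Q := (htop ▸ Subgroup.mem_top g : g ∈ Subgroup.normalizer Q)
  exact (hg q).1 hq

/-- A subrack that meets every conjugacy class of a rack containing all non-central classes is
the whole rack. -/
theorem eq_preimage_of_image_eq [Finite G] {I : Set (ConjClasses G)}
    (hI : ConjClasses.noncenter G ⊆ I) {Q : Set G} (hQ : IsSubrack (X := Quandle.Conj G) Q)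
    (hQI : ConjClasses.mk '' Q = I) : Q = ConjClasses.mk ⁻¹' I := by
  subst hQI
  refine (Set.subset_preimage_image _ _).antisymm ?_
  rintro g ⟨q, hq, hqg⟩
  obtain ⟨c, rfl⟩ := isConj_iff.1 (ConjClasses.mk_eq_mk_iff_isConj.1 hqg)
  exact conj_mem_of_noncenter_subset_image hQ hI c hq

/-- Subracks of the union of a non-central part and a set of central elements split. -/
theorem nonempty_conjSubracks_orderIso [Finite G] {Z : Set G}
    (hZ : Z ⊆ (Subgroup.center G : Set G)) :
    Nonempty (ConjSubracks (noncentralRack G ∪ Z) ≃o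
      ConjSubracks (noncentralRack G) × Set Z) := by
  -- Disjointness makes the splitting of a subrack into its parts in `R` and in `Z` unique.
  have hdisj : Disjoint (noncentralRack G) Z := by
    rw [noncentralRack_eq_compl_center]
    exact (disjoint_compl_left).mono_right hZ
  have hd : ∀ a ∈ Z, a ∉ noncentralRack G := fun a ha hr => Set.disjoint_left.1 hdisj hr ha
  refine ⟨⟨⟨fun Q => (⟨Q.1 ∩ noncentralRack G, Set.inter_subset_right, ?_⟩,
    Subtype.val ⁻¹' Q.1), fun p => ⟨p.1.1 ∪ Subtype.val '' p.2, ?_, ?_⟩, ?_, ?_⟩, ?_⟩⟩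
  · refine isSubrack_conj_iff.2 fun a ha b hb =>
      ⟨isSubrack_conj_iff.1 Q.2.2 a ha.1 b hb.1, ?_⟩
    have h := isSubrack_conj_iff.1 (isSubrack_preimage_mk (ConjClasses.noncenter G))
    rw [← noncentralRack_eq_preimage] at h
    exact h a ha.2 b hb.2
  · exact Set.union_subset_union p.1.2.1 (by rintro _ ⟨z, -, rfl⟩; exact z.2)
  · have hp := isSubrack_conj_iff.1 p.1.2.2
    refine isSubrack_conj_iff.2 ?_
    rintro a ha b (hb | ⟨z, hz, rfl⟩)
    · rcases ha with ha | ⟨z, -, rfl⟩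
      · exact Or.inl (hp a ha b hb)
      · left
        rw [← Subgroup.mem_center_iff.1 (hZ z.2) b]
        simpa using hb
    · right
      rw [Subgroup.mem_center_iff.1 (hZ z.2) a]
      exact ⟨z, hz, by simp⟩
  · intro Q
    refine Subtype.ext (Set.ext fun a => ?_)
    have := @Q.2.1 a
    simp only [Set.mem_union, Set.mem_inter_iff, Set.mem_image, Set.mem_preimage, Subtype.exists,
      exists_and_right, exists_eq_right] at this ⊢
    tauto
  · intro p
    refine Prod.ext (Subtype.ext (Set.ext fun a => ?_)) (Set.ext fun z => ?_)
    · have h1 := @p.1.2.1 a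
      have h2 := hd a
      simp only [Set.mem_union, Set.mem_inter_iff, Set.mem_image, Subtype.exists,
        exists_and_right, exists_eq_right]
      constructor
      · rintro ⟨h | ⟨h, -⟩, h'⟩
        · exact h
        · exact absurd h' (h2 h)
      · exact fun h => ⟨Or.inl h, h1 h⟩
    · have h1 := @p.1.2.1 z
      have h2 := hd z z.2
      simp only [Set.mem_preimage, Set.mem_union, Set.mem_image, Subtype.val_inj, exists_eq_right]
      tauto
  · intro Q Q'
    constructor
    · rintro ⟨h1, h2⟩ a ha
      rcases Q.2.1 ha with hr | hz
      · exact (h1 ⟨ha, hr⟩).1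
      · exact h2 (a := ⟨a, hz⟩) ha
    · exact fun h => ⟨fun a ha => ⟨h ha.1, ha.2⟩, fun z hz => h hz⟩

end ConjSubracks

/-! ### The Boolean lattice: chains of sets as superlevel sets of vectors -/

section BooleanProperPart

/-- The proper part of the Boolean lattice of subsets of `ι`. -/
abbrev ProperFinsets (ι : Type*) [Fintype ι] [DecidableEq ι] : Type _ :=
  {A : Finset ι // A.Nonempty ∧ Aᶜ.Nonempty}

/-- The vectors whose least coordinate is `0` and whose greatest coordinate is `1`. -/
def normalizedVectors (ι : Type*) : Set (ι → ℝ) :=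
  {y | (∀ i, 0 ≤ y i) ∧ (∀ i, y i ≤ 1) ∧ (∃ i, y i = 0) ∧ ∃ i, y i = 1}

variable {ι : Type*} [Fintype ι] [DecidableEq ι]

/-- The combination of the indicator vectors of the sets `A` with coefficients `x A`. -/
noncomputable def indicatorSum (x : ProperFinsets ι → ℝ) (i : ι) : ℝ :=
  ∑ A with i ∈ A.1, x A

/-- The length of the interval of levels at which `A` is the superlevel set of `y`. -/
noncomputable def levelWeight (y : ι → ℝ) (A : ProperFinsets ι) : ℝ :=
  max (A.1.inf' A.2.1 y - A.1ᶜ.sup' A.2.2 y) 0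

theorem continuous_indicatorSum : Continuous (indicatorSum (ι := ι)) := by
  unfold indicatorSum
  fun_prop

theorem continuous_levelWeight : Continuous (levelWeight (ι := ι)) := by
  refine continuous_pi fun A => ?_
  refine Continuous.max (Continuous.sub ?_ ?_) continuous_const
  · exact Continuous.finset_inf'_apply _ fun i _ => continuous_apply i
  · exact Continuous.finset_sup'_apply _ fun i _ => continuous_apply i

theorem levelWeight_nonneg (y : ι → ℝ) (A : ProperFinsets ι) : 0 ≤ levelWeight y A :=
  le_max_right _ _

theorem lt_of_levelWeight_pos {y : ι → ℝ} {A : ProperFinsets ι} (h : 0 < levelWeight y A)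
    {i j : ι} (hi : i ∈ A.1) (hj : j ∉ A.1) : y j < y i := by
  have h' : 0 < A.1.inf' A.2.1 y - A.1ᶜ.sup' A.2.2 y :=
    (lt_max_iff.1 h).resolve_right (lt_irrefl _)
  have h1 := Finset.inf'_le y hi
  have h2 := Finset.le_sup' y (Finset.mem_compl.2 hj)
  linarith

theorem le_levelWeight {y : ι → ℝ} {A : ProperFinsets ι} {r : ℝ}
    (h : ∀ i ∈ A.1, ∀ j ∉ A.1, r ≤ y i - y j) : r ≤ levelWeight y A := by
  refine le_trans ?_ (le_max_left _ _)
  obtain ⟨i, hi, hiy⟩ := Finset.exists_mem_eq_inf' A.2.1 y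
  obtain ⟨j, hj, hjy⟩ := Finset.exists_mem_eq_sup' A.2.2 y
  rw [hiy, hjy]
  exact h i hi j (Finset.mem_compl.1 hj)

theorem isChain_levelWeight_pos (y : ι → ℝ) : IsChain (· ≤ ·) {A | 0 < levelWeight y A} := by
  intro A hA B hB _
  by_contra h
  rw [not_or] at h
  obtain ⟨i, hiA, hiB⟩ := Finset.not_subset.1 h.1
  obtain ⟨j, hjB, hjA⟩ := Finset.not_subset.1 h.2
  exact lt_asymm (lt_of_levelWeight_pos hA hiA hjA) (lt_of_levelWeight_pos hB hjB hiB)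

/-- A finite layer cake formula. -/
theorem indicatorSum_levelWeight {y : ι → ℝ} (h0 : ∀ i, 0 ≤ y i) (h0' : ∃ i, y i = 0) :
    indicatorSum (levelWeight y) = y := by
  ext i
  -- `I A` is the set of levels `t` with `{j | t ≤ y j} = A`. Those with `i ∈ A` partition `(0, y
  -- i]`, so comparing lengths gives the formula. The zero coordinate of `y` makes superlevel sets
  -- at positive levels proper.
  let I : ProperFinsets ι → Set ℝ := fun A => Set.Ioc (A.1ᶜ.sup' A.2.2 y) (A.1.inf' A.2.1 y)
  have hI : ∀ {A t}, t ∈ I A ↔ (∀ j ∉ A.1, y j < t) ∧ ∀ j ∈ A.1, t ≤ y j := by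
    intro A t
    simp [I]
  have hmem : ∀ {A t}, t ∈ I A → ∀ j, j ∈ A.1 ↔ t ≤ y j := fun ht j =>
    ⟨(hI.1 ht).2 j, fun hj => by_contra fun hjA => absurd ((hI.1 ht).1 j hjA) hj.not_gt⟩
  have hunion : ⋃ A ∈ Finset.univ.filter (fun A : ProperFinsets ι => i ∈ A.1), I A =
      Set.Ioc 0 (y i) := by
    ext t
    simp only [Finset.mem_filter, Finset.mem_univ, true_and, Set.mem_iUnion, exists_prop,
      Set.mem_Ioc]
    constructor
    · rintro ⟨A, hiA, ht⟩
      obtain ⟨j, hj⟩ := A.2.2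
      exact ⟨(h0 j).trans_lt ((hI.1 ht).1 j (Finset.mem_compl.1 hj)), (hI.1 ht).2 i hiA⟩
    · rintro ⟨ht0, hti⟩
      obtain ⟨j, hj⟩ := h0'
      refine ⟨⟨Finset.univ.filter (fun j => t ≤ y j), ⟨i, by simpa using hti⟩,
        ⟨j, by simpa [hj] using ht0⟩⟩, by simpa using hti, hI.2 ⟨fun j hj => ?_, fun j hj => ?_⟩⟩
      · simpa using hj
      · simpa using hj
  have hvol := congrArg MeasureTheory.volume.real hunion
  rw [MeasureTheory.measureReal_biUnion_finset ?_ ?_ fun A _ => measure_Ioc_lt_top.ne,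
    Real.volume_real_Ioc_of_le (h0 i), sub_zero] at hvol
  · rw [← hvol]
    exact Finset.sum_congr rfl fun A _ => Real.volume_real_Ioc.symm
  · intro A _ B _ hAB
    refine Set.disjoint_left.2 fun t hA hB => hAB (Subtype.ext (Finset.ext fun j => ?_))
    rw [hmem hA, hmem hB]
  · exact fun _ _ => measurableSet_Ioc

/-- Where `y i = 1` is maximal, every set of positive weight contains `i`, so the layer cake formula
at `i` computes the total mass. -/
theorem levelWeight_mem {y : ι → ℝ} (hy : y ∈ normalizedVectors ι) :
    levelWeight y ∈ geomRealization (chainComplexOf (ProperFinsets ι)) := by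
  obtain ⟨h0, h1, h0', i, hi⟩ := hy
  refine mem_geomRealization_chainComplexOf.2
    ⟨levelWeight_nonneg y, ?_, isChain_levelWeight_pos y⟩
  have hsum := congrFun (indicatorSum_levelWeight h0 h0') i
  rw [hi] at hsum
  rw [← hsum]
  refine (Finset.sum_subset (Finset.subset_univ _) fun A _ hA => ?_).symm
  have hiA : i ∉ A.1 := by simpa using hA
  obtain ⟨j, hj⟩ := A.2.1
  by_contra hne
  have := lt_of_levelWeight_pos (lt_of_le_of_ne (levelWeight_nonneg y A) (Ne.symm hne)) hj hiA
  linarith [h1 j]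

/-- A point outside the largest set of the chain gets coordinate 0; a point of the smallest set lies
in all of them and gets the total mass 1. -/
theorem indicatorSum_mem {x : ProperFinsets ι → ℝ}
    (hx : x ∈ geomRealization (chainComplexOf (ProperFinsets ι))) :
    indicatorSum x ∈ normalizedVectors ι := by
  obtain ⟨h0, hsum, hchain⟩ := mem_geomRealization_chainComplexOf.1 hx
  let s := Finset.univ.filter (fun A : ProperFinsets ι => 0 < x A)
  have hs : ∀ {A}, A ∉ s → x A = 0 := fun {A} hA =>
    le_antisymm (not_lt.1 fun h => hA (by simpa [s] using h)) (h0 A)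
  have hne : s.Nonempty := by
    by_contra h
    rw [Finset.not_nonempty_iff_eq_empty] at h
    have : ∑ A, x A = 0 := Finset.sum_eq_zero fun A _ => hs (by simp [h])
    linarith
  have htot : ∀ {A B}, A ∈ s → B ∈ s → A ≤ B ∨ B ≤ A := fun hA hB =>
    hchain.total (by simpa [s] using hA) (by simpa [s] using hB)
  refine ⟨fun i => Finset.sum_nonneg fun A _ => h0 A, fun i => ?_, ?_, ?_⟩
  · rw [← hsum]
    exact Finset.sum_le_sum_of_subset_of_nonneg (Finset.subset_univ _) fun A _ _ => h0 A
  · obtain ⟨M, hM⟩ := s.exists_maximal hne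
    obtain ⟨j, hj⟩ := M.2.2
    refine ⟨j, Finset.sum_eq_zero fun A hA => hs fun hAs => ?_⟩
    have hAM : A ≤ M := (htot hAs hM.1).elim id fun h => hM.2 hAs h
    exact Finset.mem_compl.1 hj (hAM (by simpa using hA))
  · obtain ⟨M, hM⟩ := s.exists_minimal hne
    obtain ⟨j, hj⟩ := M.2.1
    refine ⟨j, ?_⟩
    rw [← hsum]
    refine Finset.sum_subset (Finset.subset_univ _) fun A _ hA => hs fun hAs => ?_
    have hMA : M ≤ A := (htot hAs hM.1).elim (fun h => hM.2 hAs h) id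
    exact hA (by simpa using hMA hj)

/-- Both sides have total mass 1, so a pointwise inequality suffices. -/
theorem levelWeight_indicatorSum {x : ProperFinsets ι → ℝ}
    (hx : x ∈ geomRealization (chainComplexOf (ProperFinsets ι))) :
    levelWeight (indicatorSum x) = x := by
  have hsum' := (mem_geomRealization_chainComplexOf.1 (levelWeight_mem (indicatorSum_mem hx))).2.1
  obtain ⟨h0, hsum, hchain⟩ := mem_geomRealization_chainComplexOf.1 hx
  have hle : ∀ A ∈ Finset.univ, x A ≤ levelWeight (indicatorSum x) A := by
    intro A _
    rcases (h0 A).eq_or_lt with hA | hA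
    · rw [← hA]
      exact levelWeight_nonneg _ A
    · refine le_levelWeight fun i hi j hj => ?_
      rw [indicatorSum, indicatorSum, le_sub_iff_add_le, ← Finset.sum_insert (by simpa using hj)]
      -- Only sets of positive mass matter. Such a `B` containing `j ∉ A` is comparable with `A`,
      -- hence contains `A` and therefore `i`.
      rw [← Finset.sum_filter_of_ne (p := fun B => 0 < x B)
        (fun B _ hB => lt_of_le_of_ne (h0 B) hB.symm)]
      refine Finset.sum_le_sum_of_subset_of_nonneg ?_ fun B _ _ => h0 B
      intro B hB
      simp only [Finset.mem_filter, Finset.mem_insert, Finset.mem_univ, true_and] at hB ⊢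
      rcases hB with ⟨rfl | hjB, hpos⟩
      · exact hi
      · rcases hchain.total hA hpos with h | h
        · exact h hi
        · exact absurd (h hjB) hj
  ext A
  exact ((Finset.sum_eq_sum_iff_of_le hle).1 (hsum.trans hsum'.symm) A (Finset.mem_univ A)).symm

/-- The realization of the order complex of the proper part of a Boolean lattice. -/
noncomputable def properFinsetsHomeomorph :
    geomRealization (chainComplexOf (ProperFinsets ι)) ≃ₜ normalizedVectors ι where
  toFun x := ⟨indicatorSum x.1, indicatorSum_mem x.2⟩
  invFun y := ⟨levelWeight y.1, levelWeight_mem y.2⟩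
  left_inv x := Subtype.ext (levelWeight_indicatorSum x.2)
  right_inv y := Subtype.ext (indicatorSum_levelWeight y.2.1 y.2.2.2.1)
  continuous_toFun := (continuous_indicatorSum.comp continuous_subtype_val).subtype_mk _
  continuous_invFun := (continuous_levelWeight.comp continuous_subtype_val).subtype_mk _

end BooleanProperPart

/-! ### Normalized vectors form a sphere -/

section NormalizedVectors

variable {n : ℕ}

/-- The differences of the coordinates of a vector with its first coordinate. -/
noncomputable def differences (y : Fin (n + 1) → ℝ) : EuclideanSpace ℝ (Fin n) :=
  WithLp.toLp 2 fun i => y i.succ - y 0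

/-- The least coordinate of `(0, u)`. -/
noncomputable def lowestCoord (u : EuclideanSpace ℝ (Fin n)) : ℝ :=
  Finset.univ.inf' Finset.univ_nonempty (Fin.cons 0 u.ofLp : Fin (n + 1) → ℝ)

/-- The greatest coordinate of `(0, u)`. -/
noncomputable def highestCoord (u : EuclideanSpace ℝ (Fin n)) : ℝ :=
  Finset.univ.sup' Finset.univ_nonempty (Fin.cons 0 u.ofLp : Fin (n + 1) → ℝ)

/-- The affine renormalization of `(0, u)` to least coordinate `0` and greatest coordinate `1`. -/
noncomputable def renormalize (u : EuclideanSpace ℝ (Fin n)) (j : Fin (n + 1)) : ℝ :=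
  ((Fin.cons 0 u.ofLp : Fin (n + 1) → ℝ) j - lowestCoord u) / (highestCoord u - lowestCoord u)

theorem lowestCoord_le (u : EuclideanSpace ℝ (Fin n)) (j : Fin (n + 1)) :
    lowestCoord u ≤ (Fin.cons 0 u.ofLp : Fin (n + 1) → ℝ) j :=
  Finset.inf'_le _ (Finset.mem_univ j)

theorem le_highestCoord (u : EuclideanSpace ℝ (Fin n)) (j : Fin (n + 1)) :
    (Fin.cons 0 u.ofLp : Fin (n + 1) → ℝ) j ≤ highestCoord u :=
  Finset.le_sup' _ (Finset.mem_univ j)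

theorem lowestCoord_lt_highestCoord {u : EuclideanSpace ℝ (Fin n)} (hu : u ≠ 0) :
    lowestCoord u < highestCoord u := by
  by_contra h
  refine hu (PiLp.ext fun i => ?_)
  have h1 := lowestCoord_le u 0
  have h2 := le_highestCoord u 0
  have h3 := lowestCoord_le u i.succ
  have h4 := le_highestCoord u i.succ
  simp only [Fin.cons_zero, Fin.cons_succ] at h1 h2 h3 h4
  simp only [PiLp.zero_apply]
  linarith

theorem continuous_cons_ofLp (j : Fin (n + 1)) :
    Continuous fun u : EuclideanSpace ℝ (Fin n) => (Fin.cons 0 u.ofLp : Fin (n + 1) → ℝ) j := by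
  refine Fin.cases ?_ (fun i => ?_) j
  · simpa using continuous_const
  · simp only [Fin.cons_succ]
    fun_prop

theorem continuous_lowestCoord : Continuous (lowestCoord (n := n)) :=
  Continuous.finset_inf'_apply _ fun j _ => continuous_cons_ofLp j

theorem continuous_highestCoord : Continuous (highestCoord (n := n)) :=
  Continuous.finset_sup'_apply _ fun j _ => continuous_cons_ofLp j

theorem renormalize_mem {u : EuclideanSpace ℝ (Fin n)} (hu : u ≠ 0) :
    renormalize u ∈ normalizedVectors (Fin (n + 1)) := by
  have h := sub_pos.2 (lowestCoord_lt_highestCoord hu)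
  refine ⟨fun j => div_nonneg (sub_nonneg.2 (lowestCoord_le u j)) h.le,
    fun j => (div_le_one h).2 (sub_le_sub_right (le_highestCoord u j) _), ?_, ?_⟩
  · obtain ⟨j, -, hj⟩ := Finset.exists_mem_eq_inf' Finset.univ_nonempty
      (Fin.cons 0 u.ofLp : Fin (n + 1) → ℝ)
    refine ⟨j, ?_⟩
    rw [renormalize, ← hj, lowestCoord, sub_self, zero_div]
  · obtain ⟨j, -, hj⟩ := Finset.exists_mem_eq_sup' Finset.univ_nonempty
      (Fin.cons 0 u.ofLp : Fin (n + 1) → ℝ)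
    refine ⟨j, ?_⟩
    rw [renormalize, ← hj]
    exact div_self h.ne'

theorem differences_ne_zero {y : Fin (n + 1) → ℝ} (hy : y ∈ normalizedVectors (Fin (n + 1))) :
    differences y ≠ 0 := by
  obtain ⟨-, -, ⟨i, hi⟩, j, hj⟩ := hy
  intro h
  have hconst : ∀ k, y k = y 0 := Fin.cases rfl fun k => by
    have : (differences y) k = 0 := by rw [h]; rfl
    exact sub_eq_zero.1 this
  linarith [hconst i, hconst j]

/-- The vector `(0, a • differences y)` is a positive affine image of `y`, and extreme coordinates 0
and 1 single out one vector among all such images. -/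
theorem renormalize_smul_differences {y : Fin (n + 1) → ℝ}
    (hy : y ∈ normalizedVectors (Fin (n + 1))) {a : ℝ} (ha : 0 < a) :
    renormalize (a • differences y) = y := by
  have hc : ∀ k, (Fin.cons 0 (a • differences y).ofLp : Fin (n + 1) → ℝ) k = a * (y k - y 0) :=
    Fin.cases (by simp) fun k => by simp [differences]
  obtain ⟨h0, h1, ⟨i, hi⟩, j, hj⟩ := hy
  have hlow : lowestCoord (a • differences y) = a * (0 - y 0) := by
    refine le_antisymm ?_ (Finset.le_inf' _ _ fun k _ => ?_)
    · simpa only [hc, hi] using lowestCoord_le (a • differences y) i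
    · rw [hc]
      exact mul_le_mul_of_nonneg_left (sub_le_sub_right (h0 k) _) ha.le
  have hhigh : highestCoord (a • differences y) = a * (1 - y 0) := by
    refine le_antisymm (Finset.sup'_le _ _ fun k _ => ?_) ?_
    · rw [hc]
      exact mul_le_mul_of_nonneg_left (sub_le_sub_right (h1 k) _) ha.le
    · simpa only [hc, hj] using le_highestCoord (a • differences y) j
  ext k
  rw [renormalize, hc, hlow, hhigh]
  field_simp
  ring

theorem differences_renormalize (u : EuclideanSpace ℝ (Fin n)) :
    differences (renormalize u) = (highestCoord u - lowestCoord u)⁻¹ • u := by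
  refine PiLp.ext fun i => ?_
  simp only [differences, renormalize, Fin.cons_succ, Fin.cons_zero, PiLp.smul_apply, smul_eq_mul]
  ring

theorem continuous_differences : Continuous (differences (n := n)) := by
  unfold differences
  fun_prop

/-- Vectors with extreme coordinates `0` and `1` form a sphere. -/
noncomputable def normalizedVectorsHomeomorph :
    normalizedVectors (Fin (n + 1)) ≃ₜ Metric.sphere (0 : EuclideanSpace ℝ (Fin n)) 1 where
  toFun y := ⟨‖differences y.1‖⁻¹ • differences y.1, by
    rw [mem_sphere_zero_iff_norm, norm_smul, norm_inv, norm_norm,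
      inv_mul_cancel₀ (norm_ne_zero_iff.2 (differences_ne_zero y.2))]⟩
  invFun u := ⟨renormalize u.1, renormalize_mem (ne_zero_of_mem_unit_sphere u)⟩
  left_inv y := Subtype.ext (renormalize_smul_differences y.2
    (inv_pos.2 (norm_pos_iff.2 (differences_ne_zero y.2))))
  right_inv u := by
    have h := sub_pos.2 (lowestCoord_lt_highestCoord (ne_zero_of_mem_unit_sphere u))
    refine Subtype.ext ?_
    dsimp only
    rw [differences_renormalize, norm_smul, mem_sphere_zero_iff_norm.1 u.2, mul_one, norm_inv,
      Real.norm_of_nonneg h.le, smul_smul, inv_inv, mul_inv_cancel₀ h.ne', one_smul]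
  continuous_toFun := by
    have hd : Continuous fun y : normalizedVectors (Fin (n + 1)) => differences y.1 :=
      continuous_differences.comp continuous_subtype_val
    exact ((hd.norm.inv₀ fun y => norm_ne_zero_iff.2 (differences_ne_zero y.2)).smul
      hd).subtype_mk _
  continuous_invFun := by
    refine Continuous.subtype_mk (continuous_pi fun j => ?_) _
    exact (((continuous_cons_ofLp j).sub continuous_lowestCoord).comp
      continuous_subtype_val).div ((continuous_highestCoord.sub continuous_lowestCoord).comp
      continuous_subtype_val) fun u =>
      (sub_pos.2 (lowestCoord_lt_highestCoord (ne_zero_of_mem_unit_sphere u))).ne'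

end NormalizedVectors

/-! ### From subracks to spheres -/

section SubrackSphere

variable {G : Type*} [Group G] [Finite G]

/-- Recording which conjugacy classes are met by a subrack is a homotopy equivalence onto the
proper part of a Boolean lattice. -/
theorem nonempty_subrack_homotopyEquiv_properFinsets {I : Set (ConjClasses G)}
    (hI : ConjClasses.noncenter G ⊆ I) {ι : Type*} [Fintype ι] [DecidableEq ι] (e : ι ≃ I) :
    Nonempty (geomRealization (subrackOrderComplex (ConjClasses.mk ⁻¹' I)) ≃ₕ
      geomRealization (chainComplexOf (ProperFinsets ι))) := by
  classical
  -- On subsets of the union of `I`, these form a Galois connection: `met Q ⊆ A` iff `Q ⊆ saturated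
  -- A`.
  let met : Set G → Finset ι := fun Q => {i | (e i : ConjClasses G) ∈ ConjClasses.mk '' Q}
  let saturated : Finset ι → Set G := fun A => ConjClasses.mk ⁻¹' {C | ∃ i ∈ A, (e i).1 = C}
  have mem_met : ∀ {Q i}, i ∈ met Q ↔ ∃ g ∈ Q, ConjClasses.mk g = (e i).1 := by
    intro Q i
    simp [met]
  have exists_index : ∀ {Q : Set G}, Q ⊆ ConjClasses.mk ⁻¹' I → ∀ g ∈ Q,
      ∃ i ∈ met Q, (e i).1 = ConjClasses.mk g := fun hQ g hg =>
    ⟨e.symm ⟨_, hQ hg⟩, mem_met.2 ⟨g, hg, by simp⟩, by simp⟩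
  have met_saturated : ∀ A, met (saturated A) = A := by
    intro A
    ext i
    rw [mem_met]
    constructor
    · rintro ⟨g, ⟨j, hj, hjg⟩, hgi⟩
      rwa [← e.injective (Subtype.ext (hjg.trans hgi))]
    · intro hi
      obtain ⟨g, hg⟩ := ConjClasses.exists_rep (e i).1
      exact ⟨g, ⟨i, hi, hg.symm⟩, hg⟩
  have met_full : met (ConjClasses.mk ⁻¹' I) = Finset.univ := by
    ext i
    obtain ⟨g, hg⟩ := ConjClasses.exists_rep (e i).1
    simp only [mem_met, Finset.mem_univ, iff_true]
    exact ⟨g, by simp [hg], hg⟩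
  have met_empty : met ∅ = ∅ := by
    ext i
    simp [mem_met]
  -- Jordan's theorem enters here, through `eq_preimage_of_image_eq`.
  have met_ne_univ : ∀ Q : ProperConjSubracks (ConjClasses.mk ⁻¹' I), met Q.1.1 ≠ Finset.univ := by
    intro Q hQ
    refine Q.2.2 (eq_preimage_of_image_eq hI Q.1.2.2 (Set.Subset.antisymm ?_ fun C hC => ?_))
    · exact Set.image_subset_iff.2 Q.1.2.1
    · have h : e.symm ⟨C, hC⟩ ∈ met Q.1.1 := hQ ▸ Finset.mem_univ _
      simpa using mem_met.1 h
  refine nonempty_realization_homotopyEquiv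
    (⟨fun Q => ⟨met Q.1.1, ?_, ?_⟩, ?_⟩ :
      ProperConjSubracks (ConjClasses.mk ⁻¹' I) →o ProperFinsets ι)
    (⟨fun A => ⟨⟨saturated A.1, ?_, isSubrack_preimage_mk _⟩, ?_, ?_⟩, ?_⟩ :
      ProperFinsets ι →o ProperConjSubracks (ConjClasses.mk ⁻¹' I)) ?_ ?_
  · obtain ⟨g, hg⟩ := Set.nonempty_iff_ne_empty.2 Q.2.1
    obtain ⟨i, hi, -⟩ := exists_index Q.1.2.1 g hg
    exact ⟨i, hi⟩
  · rw [Finset.nonempty_iff_ne_empty, Ne, Finset.compl_eq_empty_iff]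
    exact met_ne_univ Q
  · intro Q Q' hQ i hi
    obtain ⟨g, hg, hgi⟩ := mem_met.1 hi
    exact mem_met.2 ⟨g, hQ hg, hgi⟩
  · rintro g ⟨i, -, hi⟩
    exact Set.mem_preimage.2 (hi ▸ (e i).2)
  · intro h
    have h' := congrArg met h
    rw [met_saturated, met_empty] at h'
    exact A.2.1.ne_empty h'
  · intro h
    have h' := congrArg met h
    rw [met_saturated, met_full] at h'
    exact A.2.2.ne_empty ((Finset.compl_eq_empty_iff _).2 h')
  · rintro A B hAB g ⟨i, hi, hig⟩
    exact ⟨i, hAB hi, hig⟩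
  · exact fun A => Subtype.ext (met_saturated A.1)
  · exact fun Q g hg => exists_index Q.1.2.1 g hg

theorem nonempty_homotopyEquiv_sphereOfDim_of_toNat_eq {X : Type*} [TopologicalSpace X] {n : ℕ}
    (h : Nonempty (X ≃ₕ Metric.sphere (0 : EuclideanSpace ℝ (Fin n)) 1)) {d : ℤ}
    (hd : (d + 1).toNat = n) : Nonempty (X ≃ₕ SphereOfDim d) := by
  subst hd
  exact h

theorem nonempty_subrack_homotopyEquiv_sphere {I : Set (ConjClasses G)}
    (hI : ConjClasses.noncenter G ⊆ I) {d : ℤ} (hd : d = I.ncard - 2) :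
    Nonempty (geomRealization (subrackOrderComplex (ConjClasses.mk ⁻¹' I)) ≃ₕ SphereOfDim d) := by
  have e : Fin I.ncard ≃ I := (Finite.equivFin I).symm
  obtain ⟨h⟩ := nonempty_subrack_homotopyEquiv_properFinsets hI e
  generalize I.ncard = m at e h hd
  cases m with
  -- With `I` empty, `d = -2` and `(d + 1).toNat` truncates to 0; both spaces are empty.
  | zero =>
    have : IsEmpty (geomRealization (chainComplexOf (ProperFinsets (Fin 0)))) := by
      refine ⟨fun x => ?_⟩
      have : IsEmpty (ProperFinsets (Fin 0)) := ⟨fun A => A.2.1.elim fun i => i.elim0⟩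
      have := (mem_geomRealization_chainComplexOf.1 x.2).2.1
      simp at this
    have : IsEmpty (Metric.sphere (0 : EuclideanSpace ℝ (Fin 0)) 1) :=
      ⟨fun u => ne_zero_of_mem_unit_sphere u (Subsingleton.elim _ _)⟩
    exact nonempty_homotopyEquiv_sphereOfDim_of_toNat_eq (n := 0)
      ⟨h.trans Homeomorph.empty.toHomotopyEquiv⟩ (by omega)
  | succ n =>
    exact nonempty_homotopyEquiv_sphereOfDim_of_toNat_eq
      ⟨h.trans (properFinsetsHomeomorph.trans normalizedVectorsHomeomorph).toHomotopyEquiv⟩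
      (by omega)

/-- The one-element classes correspond bijectively to the central elements. -/
theorem ncard_noncenter_add_card_center :
    (ConjClasses.noncenter G).ncard + Nat.card (Subgroup.center G) = Nat.card (ConjClasses G) := by
  rw [← Set.ncard_add_ncard_compl (ConjClasses.noncenter G), ← (ConjClasses.mk_bijOn G).image_eq,
    (ConjClasses.mk_bijOn G).injOn.ncard_image]
  rfl

theorem ncard_noncenter_union_image_mk {Z : Set G} (hZ : Z ⊆ (Subgroup.center G : Set G)) :
    (ConjClasses.noncenter G ∪ ConjClasses.mk '' Z).ncard =
      (ConjClasses.noncenter G).ncard + Z.ncard := by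
  rw [Set.ncard_union_eq, ((ConjClasses.mk_bijOn G).injOn.mono hZ).ncard_image]
  refine Set.disjoint_right.2 ?_
  rintro _ ⟨z, hz, rfl⟩
  exact (ConjClasses.mk_bijOn G).mapsTo (hZ hz)

omit [Finite G] in
theorem noncentralRack_union_eq_preimage {Z : Set G} (hZ : Z ⊆ (Subgroup.center G : Set G)) :
    noncentralRack G ∪ Z = ConjClasses.mk ⁻¹' (ConjClasses.noncenter G ∪ ConjClasses.mk '' Z) := by
  rw [Set.preimage_union, noncentralRack_eq_preimage]
  ext g
  by_cases hg : g ∈ Subgroup.center G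
  · refine or_congr_right ⟨fun h => ⟨g, h, rfl⟩, ?_⟩
    rintro ⟨z, hz, hzg⟩
    rwa [← (ConjClasses.mk_bijOn G).injOn (hZ hz) hg hzg]
  · exact iff_of_true (Or.inl (mk_mem_noncenter_iff.2 hg)) (Or.inl (mk_mem_noncenter_iff.2 hg))

end SubrackSphere

theorem proposition1p1 (G : Type*) [Group G] [Finite G] :
    (∀ Z : Set G, Z ⊆ (Subgroup.center G : Set G) →
      Nonempty (ConjSubracks (noncentralRack G ∪ Z) ≃o
        ConjSubracks (noncentralRack G) × Set Z) ∧
      Nonempty (geomRealization (subrackOrderComplex (noncentralRack G ∪ Z)) ≃ₕ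
        SphereOfDim ((Nat.card (ConjClasses G) : ℤ) - (Nat.card (Subgroup.center G) : ℤ)
          + (Z.ncard : ℤ) - 2))) ∧
    Nonempty (geomRealization (subrackOrderComplex (Set.univ : Set G)) ≃ₕ
      SphereOfDim ((Nat.card (ConjClasses G) : ℤ) - 2)) := by
  refine ⟨fun Z hZ => ⟨nonempty_conjSubracks_orderIso hZ, ?_⟩, ?_⟩
  · rw [noncentralRack_union_eq_preimage hZ]
    refine nonempty_subrack_homotopyEquiv_sphere Set.subset_union_left ?_
    have := ncard_noncenter_add_card_center (G := G)
    rw [ncard_noncenter_union_image_mk hZ]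
    push_cast
    omega
  · have h := nonempty_subrack_homotopyEquiv_sphere (G := G) (Set.subset_univ _)
      (d := (Nat.card (ConjClasses G) : ℤ) - 2) (by rw [Set.ncard_univ])
    rwa [Set.preimage_univ] at h
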